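/- All categories below are $\mathbb{C}$-linear, and tensor products and module actions are bilinear on morphisms. A $*$-structure on a linear category is an antilinear, involutive, identity-on-objects contravariant endofunctor $f\mapsto f^*$; a morphism $u$ is unitary if $u^*u$ and $uu^*$ are identities, and a $*$-functor is a linear functor with $F(f^*)=F(f)^*$. A $*$-equivalence is a $*$-functor that has an inverse $*$-functor up to unitary natural isomorphisms. A $\mathrm{C}^*$-category is a $*$-category in which every $f:a\to b$ satisfies $f^*f=g^*g$ for some $g:a\to a$, and in which $\|f\|^2=\sup\{|\lambda| : f^*f-\lambda\,\mathrm{id}\text{ is not invertible}\}$ defines complete norms on the Hom-spaces with $\|fg\|\le\|f\|\,\|g\|$ and $\|f^*f\|=\|f\|^2$. An object $x$ is simple if $\mathrm{End}(x)\cong\mathbb{C}$. A linear category is finitely semisimple if it has finite direct sums, every object is a finite direct sum of simple objects, there are only finitely many simple objects up to isomorphism, and there are no nonzero morphisms between non-isomorphic simple objects. A unitary fusion category is a rigid, finitely semisimple monoidal $\mathrm{C}^*$-category with simple unit, unitary associators and unitors, and $(f\otimes g)^*=f^*\otimes g^*$. Let $\mathcal{C}$ be a unitary fusion category and $\mathcal{M}$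 a (left) $\mathcal{C}$-module category, with action $\vartriangleright$ and associativity isomorphisms $\mu_{c,c',m}:(c\otimes c')\vartriangleright m\to c\vartriangleright(c'\vartriangleright m)$. A unitary structure on $\mathcal{M}$ is a $*$-structure on $\mathcal{M}$ for which $\mathcal{M}$ is a finitely semisimple $\mathrm{C}^*$-category, $(f\vartriangleright g)^*=f^*\vartriangleright g^*$, the functor $I\vartriangleright-$ is a $*$-equivalence, and every $\mu_{c,c',m}$ is unitary; $\mathcal{M}$ with such a structure is a unitary module category. $\mathcal{M}$ is unitarizable if it is finitely semisimple and has a unitary structure. A module functor is a functor $F$ with coherent natural isomorphisms $f_{c,m}:F(c\vartriangleright m)\to c\vartriangleright F(m)$; it is a module equivalence if $F$ is an equivalence of categories, and a unitary module equivalence if moreover $F$ is a $*$-equivalence and every $f_{c,m}$ is unitary. An isomorphism of module functors $(F,f)\to(G,g)$ is a natural isomorphism $\eta:F\to G$ with $(c\vartriangleright\eta_m)f_{c,m}=g_{c,m}\,\eta_{c\vartriangleright m}$. **Corollary.** Let $\mathcal{M}$ be a unitarizable module category over a unitary fusion category $\mathcal{C}$. Then $\mathcal{M}$ admits a unitary structure,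 and it is unique up to unitary module equivalence: (i) for any two unitary structures $U,U'$ on $\mathcal{M}$ there is a unitary module equivalence $(\mathcal{M},U)\to(\mathcal{M},U')$ that is isomorphic, as a module functor, to the identity; (ii) more generally, for every unitary structure $U$ on $\mathcal{M}$ and every unitary module category $\mathcal{N}$ over $\mathcal{C}$, every module equivalence $\mathcal{M}\to\mathcal{N}$ is isomorphic, as a module functor, to a unitary module equivalence $(\mathcal{M},U)\to\mathcal{N}$. -/

import Mathlib

open CategoryTheory CategoryTheory.Limits CategoryTheory.MonoidalCategory
open scoped CategoryTheory.MonoidalCategory CategoryTheory.MonoidalCategory.MonoidalLeftAction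

universe v₁ v₂ v₃ u₁ u₂ u₃

noncomputable section

namespace UnitaryModule

/-! ### Star-categories and C-star-categories -/

section Star

/-- A `*`-structure on a `ℂ`-linear category: an antilinear, involutive, identity-on-objects
functor `Cᵒᵖ ⥤ C`. -/
structure StarStructure (C : Type u₁) [Category.{v₁} C] [Preadditive C] [Linear ℂ C] where
  star : ∀ {X Y : C}, (X ⟶ Y) → (Y ⟶ X)
  star_star : ∀ {X Y : C} (f : X ⟶ Y), star (star f) = f
  star_id : ∀ X : C, star (𝟙 X) = 𝟙 X
  star_comp : ∀ {X Y Z : C} (f : X ⟶ Y) (g : Y ⟶ Z), star (f ≫ g) = star g ≫ star f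
  star_add : ∀ {X Y : C} (f g : X ⟶ Y), star (f + g) = star f + star g
  star_smul : ∀ {X Y : C} (z : ℂ) (f : X ⟶ Y), star (z • f) = (starRingEnd ℂ z) • star f

variable {C : Type u₁} [Category.{v₁} C] [Preadditive C] [Linear ℂ C]
variable {D : Type u₂} [Category.{v₂} D] [Preadditive D] [Linear ℂ D]

namespace StarStructure

/-- A morphism `u` is unitary if `u* u` and `u u*` are identities. -/
def IsUnitary (S : StarStructure C) {X Y : C} (u : X ⟶ Y) : Prop :=
  u ≫ S.star u = 𝟙 X ∧ S.star u ≫ u = 𝟙 Y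

/-- The endomorphism `f* f` of the source of `f`. -/
def gram (S : StarStructure C) {X Y : C} (f : X ⟶ Y) : End X := f ≫ S.star f

/-- The moduli of the complex numbers `z` such that `f* f - z` is not invertible. -/
def spectralModuli (S : StarStructure C) {X Y : C} (f : X ⟶ Y) : Set ℝ :=
  (fun z : ℂ => ‖z‖) '' spectrum ℂ (S.gram f)

/-- The C-star norm: `‖f‖ ^ 2` is the spectral radius of `f* f`. -/
def norm (S : StarStructure C) {X Y : C} (f : X ⟶ Y) : ℝ :=
  Real.sqrt (sSup (S.spectralModuli f))

/-- The property of a `*`-category of being a C-star-category. -/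
structure IsCStar (S : StarStructure C) : Prop where
  exists_endo : ∀ {X Y : C} (f : X ⟶ Y), ∃ g : X ⟶ X, f ≫ S.star f = g ≫ S.star g
  bddAbove : ∀ {X Y : C} (f : X ⟶ Y), BddAbove (S.spectralModuli f)
  eq_zero_of_norm : ∀ {X Y : C} (f : X ⟶ Y), S.norm f = 0 → f = 0
  norm_add_le : ∀ {X Y : C} (f g : X ⟶ Y), S.norm (f + g) ≤ S.norm f + S.norm g
  norm_smul : ∀ {X Y : C} (z : ℂ) (f : X ⟶ Y), S.norm (z • f) = ‖z‖ * S.norm f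
  complete : ∀ {X Y : C} (f : ℕ → (X ⟶ Y)),
    (∀ ε > 0, ∃ n₀, ∀ m ≥ n₀, ∀ n ≥ n₀, S.norm (f m - f n) < ε) →
      ∃ g : X ⟶ Y, ∀ ε > 0, ∃ n₀, ∀ n ≥ n₀, S.norm (f n - g) < ε
  norm_comp_le : ∀ {X Y Z : C} (f : X ⟶ Y) (g : Y ⟶ Z), S.norm (f ≫ g) ≤ S.norm f * S.norm g
  norm_star_comp : ∀ {X Y : C} (f : X ⟶ Y), S.norm (f ≫ S.star f) = S.norm f ^ 2

end StarStructure

/-- A `*`-functor: a linear functor that commutes with the `*`-structures. -/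
structure IsStarFunctor (S : StarStructure C) (T : StarStructure D) (F : C ⥤ D) : Prop where
  map_add : ∀ {X Y : C} (f g : X ⟶ Y), F.map (f + g) = F.map f + F.map g
  map_smul : ∀ {X Y : C} (z : ℂ) (f : X ⟶ Y), F.map (z • f) = z • F.map f
  map_star : ∀ {X Y : C} (f : X ⟶ Y), F.map (S.star f) = T.star (F.map f)

/-- A `*`-equivalence: a `*`-functor which has an inverse `*`-functor up to unitary natural
isomorphisms. -/
def IsStarEquivalence (S : StarStructure C) (T : StarStructure D) (F : C ⥤ D) : Prop :=
  IsStarFunctor S T F ∧ ∃ G : D ⥤ C, IsStarFunctor T S G ∧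
    (∃ η : F ⋙ G ≅ 𝟭 C, ∀ X, S.IsUnitary (η.hom.app X)) ∧
    (∃ ε : G ⋙ F ≅ 𝟭 D, ∀ Y, T.IsUnitary (ε.hom.app Y))

end Star

/-! ### Finite semisimplicity -/

section Semisimple

/-- An object of a `ℂ`-linear category is simple if its endomorphism algebra is `ℂ`. -/
def IsSimpleObject {C : Type u₁} [Category.{v₁} C] [Preadditive C] [Linear ℂ C] (X : C) : Prop :=
  Nonempty (End X ≃ₐ[ℂ] ℂ)

/-- Finite semisimplicity: finite direct sums exist, every object is a finite direct sum of simple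
objects, and there are finitely many simple objects up to isomorphism. The field `hom_eq_zero`
(Schur's lemma) holds automatically in a C-star-category; it makes the notion the usual one for
linear categories without a `*`-structure. -/
structure IsFinitelySemisimple (C : Type u₁) [Category.{v₁} C] [Preadditive C] [Linear ℂ C] :
    Prop where
  [hasFiniteBiproducts : HasFiniteBiproducts C]
  exists_decomposition : ∀ X : C, ∃ (n : ℕ) (s : Fin n → C),
    (∀ i, IsSimpleObject (s i)) ∧ Nonempty (X ≅ ⨁ s)
  finite_simples : ∃ (n : ℕ) (s : Fin n → C), ∀ X : C, IsSimpleObject X →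
    ∃ i, Nonempty (X ≅ s i)
  hom_eq_zero : ∀ X Y : C, IsSimpleObject X → IsSimpleObject Y → IsEmpty (X ≅ Y) →
    ∀ f : X ⟶ Y, f = 0

end Semisimple

/-! ### Unitary fusion categories -/

/-- The property of a `*`-structure on a `ℂ`-linear monoidal category of making it a unitary
fusion category. -/
structure IsUnitaryFusion {C : Type u₁} [Category.{v₁} C] [Preadditive C] [Linear ℂ C]
    [MonoidalCategory C] [MonoidalPreadditive C] [MonoidalLinear ℂ C] (S : StarStructure C) :
    Prop where
  isCStar : S.IsCStar
  star_tensorHom : ∀ {W X Y Z : C} (f : W ⟶ X) (g : Y ⟶ Z),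
    S.star (f ⊗ₘ g) = S.star f ⊗ₘ S.star g
  associator_unitary : ∀ X Y Z : C, S.IsUnitary (α_ X Y Z).hom
  leftUnitor_unitary : ∀ X : C, S.IsUnitary (λ_ X).hom
  rightUnitor_unitary : ∀ X : C, S.IsUnitary (ρ_ X).hom
  rigid : ∀ X : C, Nonempty (HasLeftDual X) ∧ Nonempty (HasRightDual X)
  finitelySemisimple : IsFinitelySemisimple C
  unit_simple : IsSimpleObject (𝟙_ C)

/-! ### Module categories

A module category over `C` is a category with a `MonoidalLeftAction` of `C`; a module functor is a
functor `F` with an instance of `F.LeftLinear C`, whose structure isomorphism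
`F (c ⊙ₗ m) ⟶ c ⊙ₗ F m` is `Functor.OplaxLeftLinear.δₗ F c m`. -/

section Module

variable {C : Type u₁} [Category.{v₁} C] [MonoidalCategory C]

/-- The action functor `C × M ⥤ M` is bilinear on morphisms. -/
class IsBilinearAction (C : Type u₁) [Category.{v₁} C] [Preadditive C] [Linear ℂ C]
    [MonoidalCategory C] (M : Type u₂) [Category.{v₂} M] [Preadditive M] [Linear ℂ M]
    [MonoidalLeftAction C M] : Prop where
  actionHomLeft_add : ∀ {c c' : C} (f g : c ⟶ c') (m : M), (f + g) ⊵ₗ m = f ⊵ₗ m + g ⊵ₗ m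
  actionHomLeft_smul : ∀ {c c' : C} (z : ℂ) (f : c ⟶ c') (m : M),
    (z • f) ⊵ₗ m = z • (f ⊵ₗ m)
  actionHomRight_add : ∀ (c : C) {m m' : M} (f g : m ⟶ m'),
    c ⊴ₗ (f + g) = c ⊴ₗ f + c ⊴ₗ g
  actionHomRight_smul : ∀ (c : C) {m m' : M} (z : ℂ) (f : m ⟶ m'),
    c ⊴ₗ (z • f) = z • (c ⊴ₗ f)

/-- The identity functor as a module functor. -/
instance idLeftLinear {M : Type u₂} [Category.{v₂} M] [MonoidalLeftAction C M] :
    (𝟭 M).LeftLinear C where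
  μₗ c m := 𝟙 (c ⊙ₗ m)
  δₗ c m := 𝟙 (c ⊙ₗ m)
  μₗ_comp_δₗ _ _ := Category.id_comp _
  δₗ_comp_μₗ _ _ := Category.id_comp _

/-- A natural isomorphism between module functors is a module natural isomorphism if it commutes
with their structure isomorphisms. -/
def IsModuleIso (C : Type u₁) [Category.{v₁} C] [MonoidalCategory C]
    {M : Type u₂} [Category.{v₂} M] [MonoidalLeftAction C M]
    {N : Type u₃} [Category.{v₃} N] [MonoidalLeftAction C N]
    {F G : M ⥤ N} [F.LeftLinear C] [G.LeftLinear C] (η : F ≅ G) : Prop :=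
  ∀ (c : C) (m : M),
    Functor.OplaxLeftLinear.δₗ F c m ≫ c ⊴ₗ η.hom.app m =
      η.hom.app (c ⊙ₗ m) ≫ Functor.OplaxLeftLinear.δₗ G c m

variable [Preadditive C] [Linear ℂ C]

/-- A unitary structure on a linear module category `M` over `C` (with `*`-structure `S`): a
`*`-structure on `M` which makes `M` a unitary module category. -/
structure UnitaryModuleStructure (S : StarStructure C) (M : Type u₂) [Category.{v₂} M]
    [Preadditive M] [Linear ℂ M] [MonoidalLeftAction C M] extends StarStructure M where
  isCStar : toStarStructure.IsCStar
  finitelySemisimple : IsFinitelySemisimple M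
  star_actionHom : ∀ {c c' : C} {m m' : M} (f : c ⟶ c') (g : m ⟶ m'),
    star (f ⊙ₗₘ g) = S.star f ⊙ₗₘ star g
  unit_starEquivalence : IsStarEquivalence toStarStructure toStarStructure
    ((MonoidalLeftAction.curriedAction C M).obj (𝟙_ C))
  actionAssoc_unitary : ∀ (c c' : C) (m : M), toStarStructure.IsUnitary (αₗ c c' m).hom

/-- A linear module category is unitarizable if it is finitely semisimple and admits a compatible
positive `*`-structure. -/
def IsUnitarizable (S : StarStructure C) (M : Type u₂) [Category.{v₂} M]
    [Preadditive M] [Linear ℂ M] [MonoidalLeftAction C M] : Prop :=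
  IsFinitelySemisimple M ∧ Nonempty (UnitaryModuleStructure S M)

/-- A module functor `F` between unitary module categories is a unitary module equivalence. -/
structure IsUnitaryModuleEquivalence {S : StarStructure C}
    {M : Type u₂} [Category.{v₂} M] [Preadditive M] [Linear ℂ M] [MonoidalLeftAction C M]
    {N : Type u₃} [Category.{v₃} N] [Preadditive N] [Linear ℂ N] [MonoidalLeftAction C N]
    (U : UnitaryModuleStructure S M) (V : UnitaryModuleStructure S N)
    (F : M ⥤ N) [F.LeftLinear C] : Prop where
  isEquivalence : F.IsEquivalence
  isStarEquivalence : IsStarEquivalence U.toStarStructure V.toStarStructure F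
  unitary : ∀ (c : C) (m : M), V.IsUnitary (Functor.OplaxLeftLinear.δₗ F c m)

end Module

end UnitaryModule

end

/-! A module equivalence `E` is corrected in two steps. In a semisimple C*-category the morphisms
out of a simple object form a finite-dimensional Hilbert space, and an orthonormal basis is a family
of isometries with orthogonal ranges. Matching such decompositions of `X` and `E X` and conjugating
`E` by the resulting automorphisms gives an isomorphic `*`-functor `F`, which inherits the module
structure of `E`.

What remains is that the structure isomorphisms `δ` of `F` need not be unitary. The failure `δ ≫
δ*`, pulled back along `F`, is a positive automorphism of `c ⊙ₗ m`, natural in both variables and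
multiplicative in `c` (`defect`). For simple `a`, `b` it acts on the spaces `b ⟶ c ⊙ₗ a`.
Eigenvalues multiply along composable pairs of simples (`IsEigenvalue.mul`), and only finitely many
occur for given `a`, `b` because `C` has finitely many simples (`finite_isEigenvalue`). An
eigenvalue from `a` to `a` thus has finitely many powers, and being positive it is `1`. Rigidity
lets one return from `b` to `a`, so the eigenvalue from `a` to `b` is unique. The defect is
therefore a coboundary `κ b / κ a` (`exists_potential`), and rescaling `F` by `√κ` makes `δ` unitary
(`exists_unitary_rescaling`). -/

noncomputable section

namespace UnitaryModule

open MonoidalLeftAction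

/-! ### Positivity and Hilbert spaces of morphisms out of simple objects -/

section Star

variable {C : Type u₁} [Category.{v₁} C] [Preadditive C] [Linear ℂ C]

namespace StarStructure

variable (S : StarStructure C)

@[simp]
lemma star_zero (X Y : C) : S.star (0 : X ⟶ Y) = 0 := by
  simpa using S.star_smul (0 : ℂ) (0 : X ⟶ Y)

lemma star_sum {ι : Type*} (s : Finset ι) {X Y : C} (f : ι → (X ⟶ Y)) :
    S.star (∑ i ∈ s, f i) = ∑ i ∈ s, S.star (f i) := by
  classical
  induction s using Finset.induction_on with
  | empty => simp
  | insert a s ha ih => rw [Finset.sum_insert ha, Finset.sum_insert ha, S.star_add, ih]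

lemma star_ne_zero {X Y : C} {f : X ⟶ Y} (hf : f ≠ 0) : S.star f ≠ 0 := fun h =>
  hf (by rw [← S.star_star f, h, star_zero])

variable {S}

/-- Immediate from the C*-identity for the norm. -/
lemma IsCStar.eq_zero_of_comp_star_eq_zero (h : S.IsCStar) {X Y : C} {f : X ⟶ Y}
    (hf : f ≫ S.star f = 0) : f = 0 := by
  apply h.eq_zero_of_norm
  have h0 : S.norm (0 : X ⟶ X) = 0 := by simpa using h.norm_smul (0 : ℂ) (0 : X ⟶ X)
  have := h.norm_star_comp f
  rw [hf, h0] at this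
  exact pow_eq_zero_iff (two_ne_zero) |>.1 this.symm

lemma IsUnitary.of_isIso {X Y : C} {u : X ⟶ Y} [IsIso u] (hu : u ≫ S.star u = 𝟙 X) :
    S.IsUnitary u := by
  refine ⟨hu, ?_⟩
  rw [← cancel_epi u, ← Category.assoc, hu, Category.id_comp, Category.comp_id]

end StarStructure

namespace IsSimpleObject

variable {a : C}

/-- The scalar by which an endomorphism of a simple object acts. -/
def scalar (ha : IsSimpleObject a) : (a ⟶ a) →ₗ[ℂ] ℂ :=
  (Classical.choice ha).toLinearMap

lemma scalar_id (ha : IsSimpleObject a) : ha.scalar (𝟙 a) = 1 :=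
  map_one (Classical.choice ha)

lemma eq_scalar_smul (ha : IsSimpleObject a) (f : a ⟶ a) : f = ha.scalar f • 𝟙 a := by
  apply (Classical.choice ha).injective
  change ha.scalar f = ha.scalar (ha.scalar f • 𝟙 a)
  rw [map_smul, scalar_id, smul_eq_mul, mul_one]

lemma id_ne_zero (ha : IsSimpleObject a) : 𝟙 a ≠ 0 := fun h => by
  simpa [ha.scalar_id] using congrArg ha.scalar h

lemma smul_id_injective (ha : IsSimpleObject a) {z w : ℂ} (h : z • 𝟙 a = w • 𝟙 a) : z = w := by
  simpa [ha.scalar_id] using congrArg ha.scalar h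

lemma scalar_star (ha : IsSimpleObject a) (S : StarStructure C) (f : a ⟶ a) :
    ha.scalar (S.star f) = starRingEnd ℂ (ha.scalar f) := by
  conv_lhs => rw [ha.eq_scalar_smul f, S.star_smul, S.star_id, map_smul, scalar_id]
  simp

/-- The C*-axiom replaces `f` by an endomorphism of the simple object `a`, that is, by a scalar `z`,
and the composite becomes `|z|²`. This is the source of all positivity below. -/
lemma comp_star (ha : IsSimpleObject a) {S : StarStructure C} (h : S.IsCStar) {X : C}
    (f : a ⟶ X) : ∃ r : ℝ, 0 ≤ r ∧ f ≫ S.star f = (r : ℂ) • 𝟙 a := by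
  obtain ⟨g, hg⟩ := h.exists_endo f
  refine ⟨Complex.normSq (ha.scalar g), Complex.normSq_nonneg _, ?_⟩
  rw [hg]
  conv_lhs => rw [ha.eq_scalar_smul g, S.star_smul, S.star_id]
  simp [smul_smul, Complex.mul_conj, mul_comm]

lemma comp_star_pos (ha : IsSimpleObject a) {S : StarStructure C} (h : S.IsCStar) {X : C}
    {f : a ⟶ X} (hf : f ≠ 0) : ∃ r : ℝ, 0 < r ∧ f ≫ S.star f = (r : ℂ) • 𝟙 a := by
  obtain ⟨r, hr, e⟩ := ha.comp_star h f
  refine ⟨r, lt_of_le_of_ne hr ?_, e⟩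
  rintro rfl
  exact hf (h.eq_zero_of_comp_star_eq_zero (by simpa using e))

lemma of_forall_eq_smul (h0 : 𝟙 a ≠ 0) (h : ∀ f : a ⟶ a, ∃ z : ℂ, f = z • 𝟙 a) :
    IsSimpleObject a := by
  refine ⟨(AlgEquiv.ofBijective (Algebra.ofId ℂ (End a)) ⟨?_, fun f => ?_⟩).symm⟩
  · rw [injective_iff_map_eq_zero]
    intro z hz
    have hz' : z • 𝟙 a = 0 := hz
    by_contra hne
    exact h0 ((smul_eq_zero_iff_right hne).1 hz')
  · obtain ⟨z, hz⟩ := h f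
    exact ⟨z, hz.symm⟩

lemma of_iso (ha : IsSimpleObject a) {b : C} (e : a ≅ b) : IsSimpleObject b := by
  refine of_forall_eq_smul (fun h => ha.id_ne_zero ?_) fun f => ?_
  · rw [← e.hom_inv_id, ← Category.id_comp e.inv, h]; simp
  · have := ha.eq_scalar_smul (e.hom ≫ f ≫ e.inv)
    refine ⟨ha.scalar (e.hom ≫ f ≫ e.inv), ?_⟩
    rw [← cancel_epi e.hom, ← cancel_mono e.inv, Category.assoc, this]
    simp [ha.scalar_id]

/-- The inner product on morphisms out of a simple object of a C-star-category. -/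
@[reducible]
def innerCore (ha : IsSimpleObject a) {S : StarStructure C} (h : S.IsCStar) (X : C) :
    InnerProductSpace.Core ℂ (a ⟶ X) where
  inner v w := ha.scalar (w ≫ S.star v)
  conj_inner_symm v w := by
    rw [← ha.scalar_star S, S.star_comp, S.star_star]
  re_inner_nonneg v := by
    obtain ⟨r, hr, e⟩ := ha.comp_star h v
    rw [e]
    simpa [ha.scalar_id] using hr
  add_left u v w := by simp [S.star_add]
  smul_left u v z := by simp [S.star_smul]
  definite v hv := by
    apply h.eq_zero_of_comp_star_eq_zero
    rw [ha.eq_scalar_smul (v ≫ S.star v)]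
    change ha.scalar (v ≫ S.star v) = 0 at hv
    simp [hv]

/-- An orthonormal basis for `innerCore`: since `a` is simple, `v i ≫ S.star (v j)` is determined by
its scalar, which is an inner product. -/
lemma exists_orthonormal (ha : IsSimpleObject a) {S : StarStructure C} (h : S.IsCStar) (X : C)
    [FiniteDimensional ℂ (a ⟶ X)] (n : ℕ) (hn : Module.finrank ℂ (a ⟶ X) = n) :
    ∃ v : Fin n → (a ⟶ X),
      (∀ i, v i ≫ S.star (v i) = 𝟙 a) ∧ (∀ i j, i ≠ j → v i ≫ S.star (v j) = 0) ∧
      ∀ u : a ⟶ X, u = ∑ i, u ≫ S.star (v i) ≫ v i := by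
  let _ : NormedAddCommGroup (a ⟶ X) := (ha.innerCore h X).toNormedAddCommGroup
  let _ : InnerProductSpace ℂ (a ⟶ X) := InnerProductSpace.ofCore (ha.innerCore h X).toCore
  let b := (stdOrthonormalBasis ℂ (a ⟶ X)).reindex (finCongr hn)
  have hb (i j) : ha.scalar (b j ≫ S.star (b i)) = if i = j then 1 else 0 :=
    orthonormal_iff_ite.1 b.orthonormal i j
  refine ⟨b, fun i => ?_, fun i j hij => ?_, fun u => ?_⟩
  · rw [ha.eq_scalar_smul (b i ≫ S.star (b i)), hb]; simp
  · rw [ha.eq_scalar_smul (b i ≫ S.star (b j)), hb, if_neg hij.symm, zero_smul]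
  · conv_lhs => rw [← b.sum_repr' u]
    refine Finset.sum_congr rfl fun i _ => ?_
    rw [← Category.assoc]
    conv_rhs => rw [ha.eq_scalar_smul (u ≫ S.star (b i))]
    simp only [Linear.smul_comp, Category.id_comp]
    rfl

end IsSimpleObject

end Star

/-! ### Semisimplicity and orthogonal decompositions -/

section Semisimple

variable {C : Type u₁} [Category.{v₁} C] [Preadditive C] [Linear ℂ C]

variable (C) in
/-- A finite family of representatives of the isomorphism classes of simple objects. -/
structure SimpleFamily where
  K : Type
  [fintype : Fintype K]
  obj : K → C
  simple : ∀ k, IsSimpleObject (obj k)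
  eq_of_iso : ∀ {k l}, (obj k ≅ obj l) → k = l
  exists_iso : ∀ X, IsSimpleObject X → ∃ k, Nonempty (X ≅ obj k)

attribute [instance] SimpleFamily.fintype

namespace IsFinitelySemisimple

lemma nonempty_simpleFamily (h : IsFinitelySemisimple C) : Nonempty (SimpleFamily C) := by
  classical
  obtain ⟨n, s, hs⟩ := h.finite_simples
  -- The given list may contain non-simple objects and repetitions, so it is cut down to the simple
  -- ones and divided by isomorphism.
  let T := {i : Fin n // IsSimpleObject (s i)}
  let r : Setoid T := ⟨fun i j => Nonempty (s i.1 ≅ s j.1), fun _ => ⟨Iso.refl _⟩,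
    fun ⟨e⟩ => ⟨e.symm⟩, fun ⟨e⟩ ⟨f⟩ => ⟨e.trans f⟩⟩
  refine ⟨⟨Quotient r, fun k => s k.out.1, fun k => k.out.2, fun {k l} e => ?_, fun X hX => ?_⟩⟩
  · rw [← Quotient.out_eq k, ← Quotient.out_eq l]
    exact Quotient.sound ⟨e⟩
  · obtain ⟨i, ⟨e⟩⟩ := hs X hX
    let q : T := ⟨i, hX.of_iso e⟩
    obtain ⟨f⟩ : (Quotient.mk r q).out ≈ q := Quotient.mk_out q
    exact ⟨Quotient.mk r q, ⟨e.trans f.symm⟩⟩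

lemma exists_sum_eq_id (h : IsFinitelySemisimple C) (s : SimpleFamily C) (X : C) :
    ∃ (n : ℕ) (t : Fin n → s.K) (p : ∀ i, X ⟶ s.obj (t i)) (q : ∀ i, s.obj (t i) ⟶ X),
      ∑ i, p i ≫ q i = 𝟙 X := by
  have := h.hasFiniteBiproducts
  obtain ⟨n, r, hr, ⟨e⟩⟩ := h.exists_decomposition X
  choose t f using fun i => s.exists_iso (r i) (hr i)
  refine ⟨n, t, fun i => e.hom ≫ biproduct.π r i ≫ (f i).some.hom,
    fun i => (f i).some.inv ≫ biproduct.ι r i ≫ e.inv, ?_⟩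
  have : ∑ i, (e.hom ≫ biproduct.π r i ≫ (f i).some.hom) ≫
      (f i).some.inv ≫ biproduct.ι r i ≫ e.inv =
      e.hom ≫ (∑ i, biproduct.π r i ≫ biproduct.ι r i) ≫ e.inv := by
    rw [Preadditive.sum_comp, Preadditive.comp_sum]
    exact Finset.sum_congr rfl fun i _ => by simp
  rw [this, biproduct.total]
  simp

lemma finiteDimensional_simple (h : IsFinitelySemisimple C) {a b : C} (ha : IsSimpleObject a)
    (hb : IsSimpleObject b) : FiniteDimensional ℂ (a ⟶ b) := by
  by_cases hab : IsEmpty (a ≅ b)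
  · have : Subsingleton (a ⟶ b) :=
      ⟨fun f g => by rw [h.hom_eq_zero a b ha hb hab f, h.hom_eq_zero a b ha hb hab g]⟩
    infer_instance
  · obtain ⟨e⟩ := not_isEmpty_iff.1 hab
    refine FiniteDimensional.of_injective (ha.scalar ∘ₗ Linear.rightComp ℂ a e.inv) ?_
    intro f g hfg
    rw [← cancel_mono e.inv, ha.eq_scalar_smul (f ≫ e.inv), ha.eq_scalar_smul (g ≫ e.inv)]
    exact congrArg (· • 𝟙 a) hfg

lemma finiteDimensional_hom (h : IsFinitelySemisimple C) {a : C} (ha : IsSimpleObject a)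
    (X : C) : FiniteDimensional ℂ (a ⟶ X) := by
  obtain ⟨s⟩ := h.nonempty_simpleFamily
  obtain ⟨n, t, p, q, hpq⟩ := h.exists_sum_eq_id s X
  have (i : Fin n) : FiniteDimensional ℂ (a ⟶ s.obj (t i)) :=
    h.finiteDimensional_simple ha (s.simple _)
  refine FiniteDimensional.of_injective
    (LinearMap.pi fun i => Linear.rightComp ℂ a (p i)) fun f g hfg => ?_
  rw [← Category.comp_id f, ← Category.comp_id g, ← hpq, Preadditive.comp_sum,
    Preadditive.comp_sum]
  refine Finset.sum_congr rfl fun i _ => ?_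
  have : f ≫ p i = g ≫ p i := congrFun hfg i
  rw [reassoc_of% this]

/-- Simple objects separate morphisms, because identities factor through sums of them. Most
equalities below are checked this way. -/
lemma hom_ext (h : IsFinitelySemisimple C) (s : SimpleFamily C) {X Y : C} {f g : X ⟶ Y}
    (hfg : ∀ k (u : s.obj k ⟶ X), u ≫ f = u ≫ g) : f = g := by
  obtain ⟨n, t, p, q, hpq⟩ := h.exists_sum_eq_id s X
  rw [← Category.id_comp f, ← Category.id_comp g, ← hpq, Preadditive.sum_comp,
    Preadditive.sum_comp]
  exact Finset.sum_congr rfl fun i _ => by rw [Category.assoc, hfg, Category.assoc]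

lemma hom_eq_zero_of_ne (h : IsFinitelySemisimple C) (s : SimpleFamily C) {k l : s.K}
    (hkl : k ≠ l) (f : s.obj k ⟶ s.obj l) : f = 0 :=
  h.hom_eq_zero _ _ (s.simple k) (s.simple l) ⟨fun e => hkl (s.eq_of_iso e)⟩ f

end IsFinitelySemisimple

/-- An orthogonal decomposition of an object of a `*`-category: isometries with orthogonal ranges
which add up to the identity. -/
structure OrthoDecomp (S : StarStructure C) {J : Type} [Fintype J] (t : J → C) (X : C) where
  ι : ∀ j, t j ⟶ X
  ι_self : ∀ j, ι j ≫ S.star (ι j) = 𝟙 (t j)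
  ι_ne : ∀ i j, i ≠ j → ι i ≫ S.star (ι j) = 0
  total : ∑ j, S.star (ι j) ≫ ι j = 𝟙 X

/-- Assembles orthonormal bases over all simple types; Schur's lemma gives orthogonality between
different types. The multiplicities `n` are a parameter so that an object and its image under an
equivalence can share one index type. -/
lemma exists_orthoDecomp {S : StarStructure C} (hS : S.IsCStar) (h : IsFinitelySemisimple C)
    (s : SimpleFamily C) (X : C) (n : s.K → ℕ)
    (hn : ∀ k, Module.finrank ℂ (s.obj k ⟶ X) = n k) :
    Nonempty (OrthoDecomp S (fun j : Σ k, Fin (n k) => s.obj j.1) X) := by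
  classical
  have (k : s.K) : FiniteDimensional ℂ (s.obj k ⟶ X) := h.finiteDimensional_hom (s.simple k) X
  choose v h1 h2 h3 using fun k => (s.simple k).exists_orthonormal hS X (n k) (hn k)
  refine ⟨⟨fun j => v j.1 j.2, fun j => h1 _ _, ?_, ?_⟩⟩
  · rintro ⟨k, i⟩ ⟨l, j⟩ hij
    by_cases hkl : k = l
    · subst hkl
      exact h2 k i j fun e => hij (by rw [e])
    · exact h.hom_eq_zero_of_ne s hkl _
  · refine h.hom_ext s fun l u => ?_
    rw [Fintype.sum_sigma, Preadditive.comp_sum, Finset.sum_eq_single l, Preadditive.comp_sum,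
      ← h3 l u, Category.comp_id]
    · intro k _ hkl
      rw [Preadditive.comp_sum]
      refine Finset.sum_eq_zero fun i _ => ?_
      rw [← Category.assoc, h.hom_eq_zero_of_ne s hkl.symm (u ≫ _), zero_comp]
    · simp

end Semisimple

/-! ### Replacing a linear equivalence by a `*`-functor -/

section Functor

variable {C : Type u₁} [Category.{v₁} C] [Preadditive C] [Linear ℂ C]
variable {D : Type u₂} [Category.{v₂} D] [Preadditive D] [Linear ℂ D]
variable {S : StarStructure C} {T : StarStructure D}

namespace OrthoDecomp

variable {J : Type} [Fintype J] {t : J → C} {X : C}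

omit [Linear ℂ D] in
lemma map_ι_comp_sum (F : C ⥤ D) [F.Additive] (d : OrthoDecomp S t X) {Y : D}
    (f : ∀ j, F.obj (t j) ⟶ Y) (i : J) :
    F.map (d.ι i) ≫ ∑ j, F.map (S.star (d.ι j)) ≫ f j = f i := by
  classical
  rw [Preadditive.comp_sum, Finset.sum_eq_single i]
  · rw [← Category.assoc, ← F.map_comp, d.ι_self, F.map_id, Category.id_comp]
  · intro j _ hj
    rw [← Category.assoc, ← F.map_comp, d.ι_ne _ _ hj.symm, F.map_zero, zero_comp]
  · simp

lemma ι_comp_sum (d : OrthoDecomp S t X) {Y : C} (f : ∀ j, t j ⟶ Y) (i : J) :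
    d.ι i ≫ ∑ j, S.star (d.ι j) ≫ f j = f i :=
  d.map_ι_comp_sum (𝟭 C) f i

variable (F : C ⥤ D) [F.Additive]

/-- The isomorphism that identifies the images under `F` of the summands of `X` with the summands
of `Y`. -/
@[simps]
def mapIso (d : OrthoDecomp S t X) {Y : D} (e : OrthoDecomp T (fun j => F.obj (t j)) Y) :
    F.obj X ≅ Y where
  hom := ∑ j, F.map (S.star (d.ι j)) ≫ e.ι j
  inv := ∑ j, T.star (e.ι j) ≫ F.map (d.ι j)
  hom_inv_id := by
    rw [Preadditive.sum_comp]
    simp_rw [Category.assoc, e.ι_comp_sum, ← F.map_comp, ← F.map_sum, d.total, F.map_id]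
  inv_hom_id := by
    rw [Preadditive.sum_comp, ← e.total]
    refine Finset.sum_congr rfl fun i _ => ?_
    rw [Category.assoc, d.map_ι_comp_sum F e.ι]

lemma mapIso_unitary (d : OrthoDecomp S t X) {Y : D}
    (e : OrthoDecomp T (fun j => F.obj (t j)) Y)
    (hF : ∀ {A B : C} (f : A ⟶ B), F.map (S.star f) = T.star (F.map f)) :
    T.IsUnitary (d.mapIso F e).hom := by
  have : T.star (d.mapIso F e).hom = (d.mapIso F e).inv := by
    simp [T.star_sum, T.star_comp, ← hF, S.star_star]
  exact ⟨by rw [this, Iso.hom_inv_id], by rw [this, Iso.inv_hom_id]⟩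

end OrthoDecomp

variable (F : C ⥤ D) [F.Additive] [F.Linear ℂ]

lemma IsSimpleObject.map [F.Full] [F.Faithful] {a : C} (ha : IsSimpleObject a) :
    IsSimpleObject (F.obj a) := by
  refine of_forall_eq_smul (fun h => ha.id_ne_zero (F.map_injective (by simpa using h))) fun f => ?_
  obtain ⟨g, rfl⟩ := F.map_surjective f
  refine ⟨ha.scalar g, ?_⟩
  conv_lhs => rw [ha.eq_scalar_smul g]
  simp [F.map_smul]

lemma IsSimpleObject.of_map [F.Full] [F.Faithful] {a : C} (ha : IsSimpleObject (F.obj a)) :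
    IsSimpleObject a := by
  refine of_forall_eq_smul (fun h => ha.id_ne_zero ?_) fun f => ⟨ha.scalar (F.map f), ?_⟩
  · rw [← F.map_id, h, F.map_zero]
  · apply F.map_injective
    conv_lhs => rw [ha.eq_scalar_smul (F.map f)]
    simp [F.map_smul]

/-- The image of a family of representatives of the simple objects under an equivalence. -/
@[simps]
def SimpleFamily.map [F.IsEquivalence] (s : SimpleFamily C) : SimpleFamily D where
  K := s.K
  obj k := F.obj (s.obj k)
  simple k := (s.simple k).map F
  eq_of_iso e := s.eq_of_iso (F.preimageIso e)
  exists_iso Y hY := by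
    let e := F.objObjPreimageIso Y
    obtain ⟨k, ⟨f⟩⟩ := s.exists_iso (F.objPreimage Y) ((hY.of_iso e.symm).of_map F)
    exact ⟨k, ⟨e.symm.trans (F.mapIso f)⟩⟩

lemma finrank_map [F.Full] [F.Faithful] (X Y : C) :
    Module.finrank ℂ (F.obj X ⟶ F.obj Y) = Module.finrank ℂ (X ⟶ Y) :=
  (LinearEquiv.ofBijective (F.mapLinearMap ℂ (X := X) (Y := Y))
    ⟨F.map_injective, F.map_surjective⟩).finrank_eq.symm

lemma finrank_of_iso (Z : C) {X Y : C} (e : X ≅ Y) :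
    Module.finrank ℂ (Z ⟶ X) = Module.finrank ℂ (Z ⟶ Y) :=
  (Linear.homCongr ℂ (Iso.refl Z) e).finrank_eq

/-- Compatible orthogonal decompositions of an object and of an object isomorphic to its image. -/
lemma exists_orthoDecomp_pair [F.IsEquivalence] (hS : S.IsCStar) (hT : T.IsCStar)
    (hC : IsFinitelySemisimple C) (hD : IsFinitelySemisimple D) (s : SimpleFamily C)
    {X : C} {Y : D} (e : F.obj X ≅ Y) :
    ∃ n : s.K → ℕ, Nonempty (OrthoDecomp S (fun j : Σ k, Fin (n k) => s.obj j.1) X) ∧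
      Nonempty (OrthoDecomp T (fun j : Σ k, Fin (n k) => F.obj (s.obj j.1)) Y) := by
  refine ⟨fun k => Module.finrank ℂ (s.obj k ⟶ X),
    exists_orthoDecomp hS hC s X _ fun k => rfl,
    exists_orthoDecomp hT hD (s.map F) Y _ fun k => ?_⟩
  rw [← finrank_of_iso _ e]
  exact finrank_map F _ _

/-- A linear functor commutes with the `*`-structures on morphisms between simple objects. -/
lemma map_star_simple (hC : IsFinitelySemisimple C) (s : SimpleFamily C) {k l : s.K}
    (x : s.obj k ⟶ s.obj l) : F.map (S.star x) = T.star (F.map x) := by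
  by_cases hkl : k = l
  · subst hkl
    rw [(s.simple k).eq_scalar_smul x, S.star_smul, F.map_smul, F.map_smul, T.star_smul, S.star_id,
      F.map_id, T.star_id]
  · rw [hC.hom_eq_zero_of_ne s hkl x]
    simp

/-- A linear equivalence of finitely semisimple C-star-categories is isomorphic to a
`*`-functor. -/
lemma exists_starFunctor_iso [F.IsEquivalence] (hS : S.IsCStar) (hT : T.IsCStar)
    (hC : IsFinitelySemisimple C) (hD : IsFinitelySemisimple D) :
    ∃ G : C ⥤ D, Nonempty (F ≅ G) ∧ IsStarFunctor S T G := by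
  obtain ⟨s⟩ := hC.nonempty_simpleFamily
  choose n d e using fun X => exists_orthoDecomp_pair F hS hT hC hD s (Iso.refl (F.obj X))
  -- `φ X` carries the image under `F` of an orthogonal decomposition of `X`, which need not be
  -- orthogonal, to an orthogonal decomposition of `F.obj X`.
  let φ (X : C) : F.obj X ≅ F.obj X := (d X).some.mapIso F (e X).some
  refine ⟨F.copyObj F.obj φ, ⟨F.isoCopyObj _ _⟩, fun f g => ?_, fun z f => ?_, fun {X Y} f => ?_⟩
  · change (φ _).inv ≫ F.map (f + g) ≫ (φ _).hom =
      (φ _).inv ≫ F.map f ≫ (φ _).hom + (φ _).inv ≫ F.map g ≫ (φ _).hom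
    simp
  · change (φ _).inv ≫ F.map (z • f) ≫ (φ _).hom = z • ((φ _).inv ≫ F.map f ≫ (φ _).hom)
    simp [F.map_smul]
  · change (φ _).inv ≫ F.map (S.star f) ≫ (φ _).hom = T.star ((φ _).inv ≫ F.map f ≫ (φ _).hom)
    -- In the orthogonal decompositions `e`, the conjugated morphism has as matrix entries the
    -- images of morphisms between simple objects. There `F` respects the stars, and the star of a
    -- matrix is taken entrywise with transposition.
    have key {X Y : C} (f : X ⟶ Y) : (φ X).inv ≫ F.map f ≫ (φ Y).hom =
        ∑ i, ∑ j, T.star ((e X).some.ι i) ≫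
          F.map ((d X).some.ι i ≫ f ≫ S.star ((d Y).some.ι j)) ≫ (e Y).some.ι j := by
      rw [OrthoDecomp.mapIso_inv, OrthoDecomp.mapIso_hom, Preadditive.sum_comp]
      refine Finset.sum_congr rfl fun i _ => ?_
      rw [Preadditive.comp_sum, Preadditive.comp_sum]
      exact Finset.sum_congr rfl fun j _ => by simp
    rw [key, key, T.star_sum, Finset.sum_comm]
    refine Finset.sum_congr rfl fun i _ => ?_
    rw [T.star_sum]
    refine Finset.sum_congr rfl fun j _ => ?_
    rw [T.star_comp, T.star_comp, T.star_star, ← map_star_simple (S := S) F hC s, S.star_comp,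
      S.star_comp, S.star_star, Category.assoc, Category.assoc]

end Functor

/-! ### A `*`-functor that is an equivalence is a `*`-equivalence -/

section StarEquivalence

variable {C : Type u₁} [Category.{v₁} C] [Preadditive C] [Linear ℂ C]
variable {D : Type u₂} [Category.{v₂} D] [Preadditive D] [Linear ℂ D]
variable {S : StarStructure C} {T : StarStructure D}

lemma IsStarFunctor.additive {F : C ⥤ D} (hF : IsStarFunctor S T F) : F.Additive :=
  ⟨hF.map_add _ _⟩

lemma IsStarFunctor.linear {F : C ⥤ D} [F.Additive] (hF : IsStarFunctor S T F) : F.Linear ℂ :=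
  ⟨fun f z => hF.map_smul z f⟩

/-- A `*`-functor which is an equivalence of finitely semisimple C-star-categories is a
`*`-equivalence. -/
lemma IsStarFunctor.isStarEquivalence {F : C ⥤ D} (hF : IsStarFunctor S T F) [F.IsEquivalence]
    (hS : S.IsCStar) (hT : T.IsCStar) (hC : IsFinitelySemisimple C)
    (hD : IsFinitelySemisimple D) : IsStarEquivalence S T F := by
  have := hF.additive
  have := hF.linear
  obtain ⟨s⟩ := hC.nonempty_simpleFamily
  choose n d e using fun Y => exists_orthoDecomp_pair F hS hT hC hD s (F.objObjPreimageIso Y)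
  -- The isomorphisms witnessing essential surjectivity are replaced by unitary ones, so that the
  -- inverse functor built from them preserves stars.
  let u (Y : D) : F.obj (F.objPreimage Y) ≅ Y := (d Y).some.mapIso F (e Y).some
  have hu (Y : D) : T.IsUnitary (u Y).hom := (d Y).some.mapIso_unitary F (e Y).some hF.map_star
  have hu' (Y : D) : T.star (u Y).hom = (u Y).inv := by
    rw [← cancel_epi (u Y).hom, (hu Y).1, Iso.hom_inv_id]
  let G : D ⥤ C :=
    { obj := F.objPreimage
      map := fun {Y Z} f => F.preimage ((u Y).hom ≫ f ≫ (u Z).inv)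
      map_id := fun Y => F.map_injective (by simp)
      map_comp := fun f g => F.map_injective (by simp) }
  have hG {Y Z : D} (f : Y ⟶ Z) : F.map (G.map f) = (u Y).hom ≫ f ≫ (u Z).inv :=
    F.map_preimage _
  refine ⟨hF, G, ⟨fun f g => F.map_injective ?_, fun z f => F.map_injective ?_,
    fun {Y Z} f => F.map_injective ?_⟩,
    ⟨NatIso.ofComponents (fun X => F.preimageIso (u (F.obj X)))
      fun f => F.map_injective ?_, fun X => ?_⟩,
    ⟨NatIso.ofComponents u fun f => ?_, hu⟩⟩
  · simp [hG]
  · simp [hG, F.map_smul]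
  · rw [hF.map_star, hG, hG, ← hu', ← hu', T.star_comp, T.star_comp, T.star_star, Category.assoc]
  · simp [hG]
  · constructor <;> apply F.map_injective
    · simpa [hF.map_star] using (hu (F.obj X)).1
    · simpa [hF.map_star] using (hu (F.obj X)).2
  · simp [hG]

end StarEquivalence

/-! ### Transport of module functor structures -/

section Action

variable {C : Type u₁} [Category.{v₁} C] [MonoidalCategory C]
variable {M : Type u₂} [Category.{v₂} M] [MonoidalLeftAction C M]
variable {N : Type u₃} [Category.{v₃} N] [MonoidalLeftAction C N]

open Functor.LaxLeftLinear Functor.OplaxLeftLinear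

/-- The module functor structure transported along an isomorphism of functors. -/
@[reducible]
def leftLinearOfIso {E F : M ⥤ N} [E.LeftLinear C] (η : E ≅ F) : F.LeftLinear C :=
  have h₁ (c : C) (m : M) : c ⊴ₗ η.inv.app m ≫ c ⊴ₗ η.hom.app m = 𝟙 (c ⊙ₗ F.obj m) := by
    rw [← actionHomRight_comp]; simp
  have h₂ (c : C) (m : M) : c ⊴ₗ η.hom.app m ≫ c ⊴ₗ η.inv.app m = 𝟙 (c ⊙ₗ E.obj m) := by
    rw [← actionHomRight_comp]; simp
  { μₗ c m := c ⊴ₗ η.inv.app m ≫ μₗ E c m ≫ η.hom.app (c ⊙ₗ m)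
    δₗ c m := η.inv.app (c ⊙ₗ m) ≫ δₗ E c m ≫ c ⊴ₗ η.hom.app m
    μₗ_naturality_left f m := by
      rw [← action_exchange_assoc, μₗ_naturality_left_assoc, η.hom.naturality, Category.assoc,
        Category.assoc]
    μₗ_naturality_right c {m m'} f := by
      rw [← actionHomRight_comp_assoc, η.inv.naturality]
      simp
    μₗ_associativity c c' m := by
      simp only [actionHomRight_comp, tensor_actionHomRight, Category.assoc,
        reassoc_of% (h₂ c)]
      rw [← η.hom.naturality, μₗ_associativity_assoc, Iso.inv_hom_id_assoc]
    μₗ_unitality m := by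
      simp
    δₗ_naturality_left f m := by
      simp [action_exchange]
    δₗ_naturality_right c m m' f := by
      simp [← actionHomRight_comp]
    δₗ_associativity c c' m := by
      simp [reassoc_of% (h₂ c)]
    δₗ_unitality_inv m := by
      simp
    μₗ_comp_δₗ c m := by simp [h₁]
    δₗ_comp_μₗ c m := by simp [reassoc_of% (h₂ c)] }

lemma isModuleIso_leftLinearOfIso {E F : M ⥤ N} [E.LeftLinear C] (η : E ≅ F) :
    letI := leftLinearOfIso (C := C) η
    IsModuleIso C η := fun c m => by
  change δₗ E c m ≫ c ⊴ₗ η.hom.app m =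
    η.hom.app (c ⊙ₗ m) ≫ η.inv.app (c ⊙ₗ m) ≫ δₗ E c m ≫ c ⊴ₗ η.hom.app m
  simp

end Action

/-! ### Duality for the action -/

section Mate

variable {C : Type u₁} [Category.{v₁} C] [MonoidalCategory C]
variable {M : Type u₂} [Category.{v₂} M] [MonoidalLeftAction C M]

/-- The mate of a morphism `c ⊙ₗ a ⟶ b` under the adjunction between the actions of an object `c`
and of its left dual `d`. -/
def mate (d c : C) [ExactPairing d c] {a b : M} (x : c ⊙ₗ a ⟶ b) : a ⟶ d ⊙ₗ b :=
  (λₗ a).inv ≫ (η_ d c) ⊵ₗ a ≫ (αₗ d c a).hom ≫ d ⊴ₗ x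

/-- The zigzag identity of the dual pair, acting on `a`; the coherence isomorphisms of the action
are first rewritten as those of `C`. -/
lemma action_zigzag (d c : C) [ExactPairing d c] (a : M) :
    c ⊴ₗ (λₗ a).inv ≫ c ⊴ₗ (η_ d c) ⊵ₗ a ≫ c ⊴ₗ (αₗ d c a).hom ≫
      (αₗ c d (c ⊙ₗ a)).inv ≫ (ε_ d c) ⊵ₗ (c ⊙ₗ a) ≫ (λₗ (c ⊙ₗ a)).hom = 𝟙 _ := by
  have h := congrArg (· ⊵ₗ a) (ExactPairing.coevaluation_evaluation d c)
  have h₁ : c ⊴ₗ (λₗ[C] a).inv = (ρ_ c).inv ⊵ₗ a ≫ (αₗ c (𝟙_ C) a).hom := by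
    rw [← cancel_mono (c ⊴ₗ (λₗ[C] a).hom), actionHomRight_inv_hom, Category.assoc,
      ← rightUnitor_actionHom, inv_hom_actionHomLeft]
  have h₂ : c ⊴ₗ (αₗ d c a).hom ≫ (αₗ c d (c ⊙ₗ a)).inv =
      (αₗ c (d ⊗ c) a).inv ≫ (α_ c d c).inv ⊵ₗ a ≫ (αₗ (c ⊗ d) c a).hom := by
    rw [Iso.eq_inv_comp, ← cancel_epi ((α_ c d c).hom ⊵ₗ a), hom_inv_actionHomLeft_assoc,
      associator_actionHom_assoc, Iso.hom_inv_id, Category.comp_id]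
  have h₃ : (λₗ (c ⊙ₗ a)).hom = (αₗ (𝟙_ C) c a).inv ≫ (λ_ c).hom ⊵ₗ a := by simp
  rw [reassoc_of% h₂, h₁, h₃, actionHomLeft_action]
  simp only [comp_actionHomLeft, whiskerLeft_actionHomLeft, Category.assoc] at h ⊢
  simp only [Iso.hom_inv_id_assoc, reassoc_of% h, inv_hom_actionHomLeft_assoc,
    inv_hom_actionHomLeft]

/-- Since `x` can be recovered from its mate, the mate of a nonzero morphism is nonzero. -/
lemma mate_recover (d c : C) [ExactPairing d c] {a b : M} (x : c ⊙ₗ a ⟶ b) :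
    c ⊴ₗ mate d c x ≫ (αₗ c d b).inv ≫ (ε_ d c) ⊵ₗ b ≫ (λₗ b).hom = x := by
  have h₁ : c ⊴ₗ d ⊴ₗ x ≫ (αₗ c d b).inv = (αₗ c d _).inv ≫ (c ⊗ d) ⊴ₗ x := by simp
  simp only [mate, actionHomRight_comp, Category.assoc]
  rw [reassoc_of% h₁, action_exchange_assoc, ← actionUnitIso_hom_naturality]
  have := action_zigzag d c a
  rw [reassoc_of% this]

end Mate

/-! ### Positive cocycles and their eigenvalues -/

section Cocycle

variable {C : Type u₁} [Category.{v₁} C] [MonoidalCategory C]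
variable {M : Type u₂} [Category.{v₂} M] [Preadditive M] [Linear ℂ M] [MonoidalLeftAction C M]

variable (C) in
/-- A natural family of positive automorphisms of the objects `c ⊙ₗ m` which is multiplicative
in `c`. -/
structure PositiveCocycle (T : StarStructure M) where
  app : ∀ (c : C) (m : M), c ⊙ₗ m ⟶ c ⊙ₗ m
  naturality_left : ∀ {c c' : C} (f : c ⟶ c') (m : M),
    f ⊵ₗ m ≫ app c' m = app c m ≫ f ⊵ₗ m
  naturality_right : ∀ (c : C) {m m' : M} (f : m ⟶ m'),
    c ⊴ₗ f ≫ app c m' = app c m ≫ c ⊴ₗ f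
  assoc : ∀ (c d : C) (m : M),
    app (c ⊗ d) m ≫ (αₗ c d m).hom = (αₗ c d m).hom ≫ c ⊴ₗ app d m ≫ app c (d ⊙ₗ m)
  star_app : ∀ (c : C) (m : M), T.star (app c m) = app c m
  pos : ∀ {c : C} {a b : M} (_ : IsSimpleObject b) (v : b ⟶ c ⊙ₗ a) (_ : v ≠ 0) (z : ℂ),
    v ≫ app c a = z • v → ∃ r : ℝ, 0 < r ∧ z = r

namespace PositiveCocycle

variable {T : StarStructure M} (g : PositiveCocycle C T)

/-- `r` is an eigenvalue of the cocycle on the `b`-isotypic part of some `c ⊙ₗ a`. -/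
def IsEigenvalue (a b : M) (r : ℝ) : Prop :=
  ∃ (c : C) (v : b ⟶ c ⊙ₗ a), v ≠ 0 ∧ v ≫ g.app c a = (r : ℂ) • v

/-- Composition with the cocycle as an endomorphism of the multiplicity space. -/
def endo (c : C) (a b : M) : Module.End ℂ (b ⟶ c ⊙ₗ a) :=
  Linear.rightComp ℂ b (g.app c a)

@[simp]
lemma endo_apply (c : C) (a b : M) (v : b ⟶ c ⊙ₗ a) : g.endo c a b v = v ≫ g.app c a := rfl

variable {g}

lemma IsEigenvalue.pos {a b : M} (hb : IsSimpleObject b) {r : ℝ} (h : g.IsEigenvalue a b r) :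
    0 < r := by
  obtain ⟨c, v, hv, e⟩ := h
  obtain ⟨r', hr', e'⟩ := g.pos hb v hv _ e
  rwa [Complex.ofReal_injective e']

lemma exists_isEigenvalue (g : PositiveCocycle C T) (hM : IsFinitelySemisimple M) {a b : M}
    (hb : IsSimpleObject b) {c : C} {v : b ⟶ c ⊙ₗ a} (hv : v ≠ 0) :
    ∃ r, g.IsEigenvalue a b r := by
  have : FiniteDimensional ℂ (b ⟶ c ⊙ₗ a) := hM.finiteDimensional_hom hb _
  have : Nontrivial (b ⟶ c ⊙ₗ a) := ⟨v, 0, hv⟩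
  obtain ⟨z, hz⟩ := Module.End.exists_eigenvalue (g.endo c a b)
  obtain ⟨w, hw⟩ := hz.exists_hasEigenvector
  have e : w ≫ g.app c a = z • w := hw.apply_eq_smul
  obtain ⟨r, hr, rfl⟩ := g.pos hb w hw.2 z e
  exact ⟨r, c, w, hw.2, e⟩

lemma exists_isEigenvalue_self (g : PositiveCocycle C T) (hM : IsFinitelySemisimple M) {a : M}
    (ha : IsSimpleObject a) : ∃ r, g.IsEigenvalue a a r :=
  g.exists_isEigenvalue hM ha (v := (λₗ[C] a).inv) fun h0 => ha.id_ne_zero (by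
    rw [← (λₗ[C] a).inv_hom_id, h0, zero_comp])

/-- The cocycle is self-adjoint, hence diagonalizable on the Hilbert space `b ⟶ c ⊙ₗ a`; with one
possible eigenvalue it is a scalar. -/
lemma comp_app_eq_smul (g : PositiveCocycle C T) (hT : T.IsCStar)
    (hM : IsFinitelySemisimple M) {a b : M} (hb : IsSimpleObject b) {r : ℝ}
    (h : ∀ r', g.IsEigenvalue a b r' → r' = r) {c : C} (v : b ⟶ c ⊙ₗ a) :
    v ≫ g.app c a = (r : ℂ) • v := by
  have : FiniteDimensional ℂ (b ⟶ c ⊙ₗ a) := hM.finiteDimensional_hom hb _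
  let _ : NormedAddCommGroup (b ⟶ c ⊙ₗ a) := (hb.innerCore hT _).toNormedAddCommGroup
  let _ : InnerProductSpace ℂ (b ⟶ c ⊙ₗ a) := InnerProductSpace.ofCore (hb.innerCore hT _).toCore
  have hsymm : (g.endo c a b).IsSymmetric := fun v w => by
    change hb.scalar (w ≫ T.star (v ≫ g.app c a)) = hb.scalar ((w ≫ g.app c a) ≫ T.star v)
    rw [T.star_comp, g.star_app, Category.assoc]
  have htop := (Submodule.orthogonal_eq_bot_iff).1
    hsymm.orthogonalComplement_iSup_eigenspaces_eq_bot
  have hle : ⨆ z, (g.endo c a b).eigenspace z ≤ (g.endo c a b).eigenspace (r : ℂ) := by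
    refine iSup_le fun z w hw => ?_
    by_cases hw0 : w = 0
    · rw [hw0]; exact Submodule.zero_mem _
    have e : w ≫ g.app c a = z • w := Module.End.mem_eigenspace_iff.1 hw
    obtain ⟨r', -, rfl⟩ := g.pos hb w hw0 z e
    rwa [← h r' ⟨c, w, hw0, e⟩]
  rw [htop] at hle
  exact Module.End.mem_eigenspace_iff.1 (hle (Submodule.mem_top (x := v)))

variable [Preadditive C] [Linear ℂ C]

/-- Eigenvectors `v : b ⟶ d ⊙ₗ a` and `w : b' ⟶ c ⊙ₗ b` compose to one for `c ⊗ d`, by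
multiplicativity and naturality of the cocycle. -/
lemma IsEigenvalue.mul [IsBilinearAction C M] (hT : T.IsCStar) {a b b' : M}
    (hb : IsSimpleObject b) {r r' : ℝ} (h : g.IsEigenvalue a b r) (h' : g.IsEigenvalue b b' r') :
    g.IsEigenvalue a b' (r * r') := by
  obtain ⟨d, v, hv, e⟩ := h
  obtain ⟨c, w, hw, e'⟩ := h'
  refine ⟨c ⊗ d, w ≫ c ⊴ₗ v ≫ (αₗ c d a).inv, fun h0 => hw ?_, ?_⟩
  -- The composite is nonzero because `v` has a one-sided inverse, namely a positive multiple of its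
  -- star.
  · obtain ⟨t, ht, et⟩ := hb.comp_star_pos hT hv
    have h1 : w ≫ c ⊴ₗ v = 0 := by
      rw [← cancel_mono (αₗ c d a).inv, Category.assoc, h0, zero_comp]
    have h2 : w ≫ c ⊴ₗ (v ≫ T.star v) = 0 := by
      rw [actionHomRight_comp, reassoc_of% h1, zero_comp]
    rw [et, IsBilinearAction.actionHomRight_smul, actionHomRight_id, Linear.comp_smul,
      Category.comp_id] at h2
    exact (smul_eq_zero_iff_right (by exact_mod_cast ht.ne')).1 h2
  · have h1 : (αₗ c d a).inv ≫ g.app (c ⊗ d) a =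
        c ⊴ₗ g.app d a ≫ g.app c (d ⊙ₗ a) ≫ (αₗ c d a).inv := by
      rw [Iso.inv_comp_eq, ← cancel_mono (αₗ c d a).hom, g.assoc]
      simp
    simp only [Category.assoc]
    rw [h1, ← actionHomRight_comp_assoc, e, IsBilinearAction.actionHomRight_smul,
      ← Category.assoc (_ • _), Linear.smul_comp, g.naturality_right, ← Category.assoc w,
      Linear.comp_smul, reassoc_of% e']
    simp only [Linear.smul_comp, Category.assoc, smul_smul, Complex.ofReal_mul]

/-- By naturality in `c`, an eigenvector projects to an eigenvector, nonzero for some summand, with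
`c` replaced by one of finitely many simple objects. -/
lemma finite_isEigenvalue [IsBilinearAction C M] (hC : IsFinitelySemisimple C)
    (hM : IsFinitelySemisimple M) {a b : M} (hb : IsSimpleObject b) :
    {r | g.IsEigenvalue a b r}.Finite := by
  obtain ⟨s⟩ := hC.nonempty_simpleFamily
  have hfin (c : C) : FiniteDimensional ℂ (b ⟶ c ⊙ₗ a) := hM.finiteDimensional_hom hb _
  have key : (⋃ k, {z : ℂ | (g.endo (s.obj k) a b).HasEigenvalue z}).Finite :=
    Set.finite_iUnion fun k => Module.End.finite_hasEigenvalue _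
  refine (key.preimage (f := ((↑) : ℝ → ℂ)) Complex.ofReal_injective.injOn).subset ?_
  rintro r ⟨c, v, hv, e⟩
  obtain ⟨n, t, p, q, hpq⟩ := hC.exists_sum_eq_id s c
  obtain ⟨i, hi⟩ : ∃ i, v ≫ p i ⊵ₗ a ≠ 0 := by
    by_contra! h0
    refine hv ?_
    have hsum : (∑ i, p i ≫ q i) ⊵ₗ a = ∑ i, (p i ≫ q i) ⊵ₗ a :=
      map_sum (AddMonoidHom.mk' (fun f : c ⟶ c => f ⊵ₗ a)
        fun f f' => IsBilinearAction.actionHomLeft_add f f' a) _ _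
    rw [← Category.comp_id v, ← id_actionHomLeft, ← hpq, hsum, Preadditive.comp_sum]
    exact Finset.sum_eq_zero fun i _ => by
      rw [comp_actionHomLeft, reassoc_of% (h0 i), zero_comp]
  refine Set.mem_iUnion.2 ⟨t i, Module.End.hasEigenvalue_of_hasEigenvector (x := v ≫ p i ⊵ₗ a)
    ⟨Module.End.mem_eigenspace_iff.2 ?_, hi⟩⟩
  rw [endo_apply, Category.assoc, g.naturality_left, reassoc_of% e, Linear.smul_comp]

/-- The mate of `T.star v` is a nonzero morphism from `a` to the dual of `c` acting on `b`, so its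
multiplicity space carries some eigenvalue. -/
lemma IsEigenvalue.exists_symm [IsBilinearAction C M] (hrigid : ∀ c : C, Nonempty (HasLeftDual c))
    (hM : IsFinitelySemisimple M) {a b : M} (ha : IsSimpleObject a) {r : ℝ}
    (h : g.IsEigenvalue a b r) : ∃ r', g.IsEigenvalue b a r' := by
  obtain ⟨c, v, hv, -⟩ := h
  obtain ⟨hd⟩ := hrigid c
  refine g.exists_isEigenvalue hM ha (v := mate hd.leftDual c (T.star v)) fun h0 => ?_
  refine T.star_ne_zero hv ?_
  have h1 : c ⊴ₗ (0 : a ⟶ hd.leftDual ⊙ₗ b) = 0 := by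
    simpa using IsBilinearAction.actionHomRight_smul c (0 : ℂ) (0 : a ⟶ hd.leftDual ⊙ₗ b)
  rw [← mate_recover hd.leftDual c (T.star v), h0, h1, zero_comp]

lemma IsEigenvalue.eq_one [IsBilinearAction C M] (hT : T.IsCStar) (hC : IsFinitelySemisimple C)
    (hM : IsFinitelySemisimple M) {a : M} (ha : IsSimpleObject a) {r : ℝ}
    (h : g.IsEigenvalue a a r) : r = 1 := by
  by_contra hr
  -- The exponent starts at one: the zeroth power would require `1` to be known as an eigenvalue.
  have hpow (n : ℕ) : g.IsEigenvalue a a (r ^ (n + 1)) := by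
    induction n with
    | zero => simpa using h
    | succ n ih => rw [pow_succ]; exact ih.mul hT ha h
  have hinj : Function.Injective fun n : ℕ => r ^ (n + 1) := fun m n hmn =>
    Nat.succ_injective (pow_right_injective₀ (h.pos ha) hr hmn)
  exact Set.infinite_of_injective_forall_mem (s := {r | g.IsEigenvalue a a r}) hinj hpow
    (finite_isEigenvalue hC hM ha)

/-- Multiplying either eigenvalue by the same return eigenvalue `t` gives an eigenvalue from `a` to
itself, which is `1`. -/
lemma IsEigenvalue.unique [IsBilinearAction C M] (hT : T.IsCStar) (hC : IsFinitelySemisimple C)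
    (hrigid : ∀ c : C, Nonempty (HasLeftDual c)) (hM : IsFinitelySemisimple M) {a b : M}
    (ha : IsSimpleObject a) (hb : IsSimpleObject b) {r r' : ℝ} (h : g.IsEigenvalue a b r)
    (h' : g.IsEigenvalue a b r') : r = r' := by
  obtain ⟨t, ht⟩ := h.exists_symm hrigid hM ha
  have h1 := (h.mul hT hb ht).eq_one hT hC hM ha
  have h2 := (h'.mul hT hb ht).eq_one hT hC hM ha
  exact mul_right_cancel₀ (ht.pos ha).ne' (h1.trans h2.symm)

/-- The cocycle is a coboundary on multiplicity spaces. -/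
lemma exists_potential [IsBilinearAction C M] (g : PositiveCocycle C T) (hT : T.IsCStar)
    (hC : IsFinitelySemisimple C) (hrigid : ∀ c : C, Nonempty (HasLeftDual c))
    (hM : IsFinitelySemisimple M) (s : SimpleFamily M) :
    ∃ κ : s.K → ℝ, (∀ k, 0 < κ k) ∧ ∀ (c : C) (k l : s.K) (v : s.obj l ⟶ c ⊙ₗ s.obj k),
      (κ k : ℂ) • v ≫ g.app c (s.obj k) = (κ l : ℂ) • v := by
  -- The classes are the connected components of `M` under the action. A representative serves as
  -- base point, and `κ l` is the eigenvalue from it to `l`.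
  let R : Setoid s.K := ⟨fun k l => ∃ r, g.IsEigenvalue (s.obj k) (s.obj l) r,
    fun k => g.exists_isEigenvalue_self hM (s.simple k),
    fun {k l} ⟨r, hr⟩ => hr.exists_symm hrigid hM (s.simple k),
    fun {k l m} ⟨r, hr⟩ ⟨r', hr'⟩ => ⟨r * r', hr.mul hT (s.simple l) hr'⟩⟩
  choose κ hκ using fun l : s.K => (Quotient.mk_out (s := R) l)
  have hpos (k : s.K) : 0 < κ k := (hκ k).pos (s.simple k)
  refine ⟨κ, hpos, fun c k l v => ?_⟩
  by_cases hv : v = 0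
  · simp [hv]
  have hkl : R k l := g.exists_isEigenvalue hM (s.simple l) hv
  have hbase : Quotient.mk R k = Quotient.mk R l := Quotient.sound hkl
  have hk := hκ k
  rw [hbase] at hk
  rw [g.comp_app_eq_smul hT hM (s.simple l) (r := κ l / κ k) ?_ v, smul_smul]
  · congr 1
    have : (κ k : ℂ) ≠ 0 := Complex.ofReal_ne_zero.2 (hpos k).ne'
    push_cast
    field_simp
  · intro r hr
    rw [eq_div_iff (hpos k).ne', mul_comm]
    exact (hk.mul hT (s.simple k) hr).unique hT hC hrigid hM (s.simple _) (s.simple l) (hκ l)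

end PositiveCocycle

/-- A function on the simple objects gives a natural endomorphism of the identity functor. -/
lemma exists_central {M : Type u₂} [Category.{v₂} M] [Preadditive M] [Linear ℂ M]
    (hM : IsFinitelySemisimple M) (s : SimpleFamily M) (φ : s.K → ℂ) :
    ∃ Θ : ∀ X : M, X ⟶ X, (∀ {X Y : M} (f : X ⟶ Y), f ≫ Θ Y = Θ X ≫ f) ∧
      ∀ (X : M) (k : s.K) (u : s.obj k ⟶ X), u ≫ Θ X = φ k • u := by
  choose n t p q hpq using hM.exists_sum_eq_id s
  let Θ (X : M) : X ⟶ X := ∑ i, φ (t X i) • (p X i ≫ q X i)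
  have hΘ (X : M) (k : s.K) (u : s.obj k ⟶ X) : u ≫ Θ X = φ k • u := by
    conv_rhs => rw [← Category.comp_id u, ← hpq X, Preadditive.comp_sum, Finset.smul_sum]
    rw [Preadditive.comp_sum]
    refine Finset.sum_congr rfl fun i _ => ?_
    by_cases hk : k = t X i
    · rw [Linear.comp_smul, congrArg φ hk]
    · rw [Linear.comp_smul, ← Category.assoc, hM.hom_eq_zero_of_ne s hk (u ≫ _)]
      simp
  refine ⟨Θ, fun {X Y} f => hM.hom_ext s fun k u => ?_, hΘ⟩
  rw [← Category.assoc, ← Category.assoc, hΘ, hΘ, Linear.smul_comp]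

end Cocycle

open Functor.LaxLeftLinear Functor.OplaxLeftLinear

/-! ### Positive rescalings of the identity functor -/

section Central

variable {M : Type u₂} [Category.{v₂} M] [Preadditive M] [Linear ℂ M]

/-- A positive function on the simple objects gives a self-adjoint natural automorphism of the
identity functor. -/
lemma exists_central_iso (hM : IsFinitelySemisimple M) (s : SimpleFamily M) (T : StarStructure M)
    (φ : s.K → ℝ) (hφ : ∀ k, 0 < φ k) :
    ∃ Θ : ∀ X : M, X ≅ X, (∀ {X Y : M} (f : X ⟶ Y), f ≫ (Θ Y).hom = (Θ X).hom ≫ f) ∧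
      (∀ (X : M) (k : s.K) (u : s.obj k ⟶ X), u ≫ (Θ X).hom = (φ k : ℂ) • u) ∧
      (∀ X, T.star (Θ X).hom = (Θ X).hom) ∧ ∀ X, T.star (Θ X).inv = (Θ X).inv := by
  obtain ⟨A, hnat, hA⟩ := exists_central hM s fun k => (φ k : ℂ)
  obtain ⟨B, hnat', hB⟩ := exists_central hM s fun k => ((φ k)⁻¹ : ℂ)
  have hne (k : s.K) : (φ k : ℂ) ≠ 0 := Complex.ofReal_ne_zero.2 (hφ k).ne'
  have hstar (ψ : s.K → ℂ) (hψ : ∀ k, starRingEnd ℂ (ψ k) = ψ k) (Θ : ∀ X : M, X ⟶ X)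
      (hΘ : ∀ {X Y : M} (f : X ⟶ Y), f ≫ Θ Y = Θ X ≫ f)
      (hΘ' : ∀ (X : M) (k : s.K) (u : s.obj k ⟶ X), u ≫ Θ X = ψ k • u) (X : M) :
      T.star (Θ X) = Θ X := by
    refine hM.hom_ext s fun k u => ?_
    have h1 : Θ X ≫ T.star u = ψ k • T.star u := by
      have h := hΘ' (s.obj k) k (𝟙 _)
      rw [Category.id_comp] at h
      rw [← hΘ, h, Linear.comp_smul, Category.comp_id]
    have h2 := congrArg T.star h1
    rw [T.star_comp, T.star_smul, T.star_star, hψ] at h2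
    rw [h2, hΘ']
  refine ⟨fun X => ⟨A X, B X, hM.hom_ext s fun k u => ?_, hM.hom_ext s fun k u => ?_⟩, hnat, hA,
    hstar _ (by simp) A hnat hA, hstar _ (by simp) B hnat' hB⟩
  · rw [← Category.assoc, hA, Linear.smul_comp, hB, smul_smul, mul_inv_cancel₀ (hne k), one_smul,
      Category.comp_id]
  · rw [← Category.assoc, hB, Linear.smul_comp, hA, smul_smul, inv_mul_cancel₀ (hne k), one_smul,
      Category.comp_id]

end Central

/-! ### Making a module equivalence unitary -/

section ModuleFunctor

variable {C : Type u₁} [Category.{v₁} C] [Preadditive C] [Linear ℂ C] [MonoidalCategory C]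
variable {M : Type u₂} [Category.{v₂} M] [Preadditive M] [Linear ℂ M] [MonoidalLeftAction C M]
variable {N : Type u₃} [Category.{v₃} N] [Preadditive N] [Linear ℂ N] [MonoidalLeftAction C N]

variable (C) in
/-- A module functor commutes with multiplication by scalars. -/
lemma map_smul_of_leftLinear [IsBilinearAction C M] [IsBilinearAction C N] (E : M ⥤ N)
    [E.LeftLinear C] {X Y : M} (f : X ⟶ Y) (z : ℂ) : E.map (z • f) = z • E.map f := by
  -- A scalar on `𝟙_ C ⊙ₗ m` comes from a scalar on `𝟙_ C`, and `δₗ` is natural in that variable.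
  have h1 (m : M) : E.map (z • 𝟙 (𝟙_ C ⊙ₗ m)) = z • 𝟙 _ := by
    have h := δₗ_naturality_left E (z • 𝟙 (𝟙_ C)) m
    rw [IsBilinearAction.actionHomLeft_smul, IsBilinearAction.actionHomLeft_smul,
      id_actionHomLeft, id_actionHomLeft] at h
    rw [← cancel_mono (δₗ E (𝟙_ C) m), h]
    simp
  have h2 : z • f = (λₗ[C] X).inv ≫ (z • 𝟙 (𝟙_ C ⊙ₗ X)) ≫ (λₗ[C] X).hom ≫ f := by simp
  rw [h2, E.map_comp, E.map_comp, h1, Linear.smul_comp, Linear.comp_smul, Category.id_comp,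
    ← E.map_comp, Iso.inv_hom_id_assoc]

namespace UnitaryModuleStructure

variable {S : StarStructure C} (V : UnitaryModuleStructure S N)

lemma star_actionHomLeft {c c' : C} (f : c ⟶ c') (n : N) :
    V.star (f ⊵ₗ n) = S.star f ⊵ₗ n := by
  rw [← actionHom_id, V.star_actionHom, V.star_id, actionHom_id]

lemma star_actionHomRight (c : C) {n n' : N} (f : n ⟶ n') :
    V.star (c ⊴ₗ f) = c ⊴ₗ V.star f := by
  rw [← id_actionHom, V.star_actionHom, S.star_id, id_actionHom]

lemma star_actionAssoc_hom (c c' : C) (n : N) : V.star (αₗ c c' n).hom = (αₗ c c' n).inv := by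
  rw [← cancel_epi (αₗ c c' n).hom, (V.actionAssoc_unitary c c' n).1, Iso.hom_inv_id]

variable (U : UnitaryModuleStructure S M) (F : M ⥤ N) [F.LeftLinear C]
  (hF : IsStarFunctor U.toStarStructure V.toStarStructure F)

include hF

/-- The star of the naturality square of `δₗ`; it makes the defect natural. -/
lemma star_δ_naturality_left {c c' : C} (f : c ⟶ c') (m : M) :
    V.star (δₗ F c m) ≫ F.map (f ⊵ₗ m) = f ⊵ₗ F.obj m ≫ V.star (δₗ F c' m) := by
  have h := congrArg V.star (δₗ_naturality_left F (S.star f) m)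
  rw [V.star_comp, V.star_comp, ← hF.map_star, U.star_actionHomLeft, V.star_actionHomLeft,
    S.star_star] at h
  exact h

lemma star_δ_naturality_right (c : C) {m m' : M} (f : m ⟶ m') :
    V.star (δₗ F c m) ≫ F.map (c ⊴ₗ f) = c ⊴ₗ F.map f ≫ V.star (δₗ F c m') := by
  have h := congrArg V.star (δₗ_naturality_right F c (U.star f))
  rw [V.star_comp, V.star_comp, ← hF.map_star, U.star_actionHomRight, V.star_actionHomRight,
    ← hF.map_star, U.star_star] at h
  exact h

/-- The failure of a module `*`-functor to be unitary, as a positive cocycle. -/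
def defect [F.IsEquivalence] : PositiveCocycle C U.toStarStructure where
  app c m := F.preimage (δₗ F c m ≫ V.star (δₗ F c m))
  naturality_left f m := F.map_injective (by
    simp only [F.map_comp, F.map_preimage, Category.assoc]
    rw [star_δ_naturality_left V U F hF, δₗ_naturality_left_assoc])
  naturality_right c m m' f := F.map_injective (by
    simp only [F.map_comp, F.map_preimage, Category.assoc]
    rw [star_δ_naturality_right V U F hF, δₗ_naturality_right_assoc])
  assoc c d m := F.map_injective (by
    have h1 : δₗ F (c ⊗ d) m = F.map (αₗ c d m).hom ≫ δₗ F c (d ⊙ₗ m) ≫ c ⊴ₗ δₗ F d m ≫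
        (αₗ c d (F.obj m)).inv := by
      rw [← cancel_mono (αₗ c d (F.obj m)).hom, δₗ_associativity]
      simp
    have h2 : V.star (δₗ F (c ⊗ d) m) = (αₗ c d (F.obj m)).hom ≫ c ⊴ₗ V.star (δₗ F d m) ≫
        V.star (δₗ F c (d ⊙ₗ m)) ≫ F.map (αₗ c d m).inv := by
      rw [h1, ← V.star_actionAssoc_hom, V.star_comp, V.star_comp, V.star_comp, V.star_star,
        V.star_actionHomRight, ← hF.map_star, U.star_actionAssoc_hom]
      simp only [Category.assoc]
    have h3 : F.map (c ⊴ₗ F.preimage (δₗ F d m ≫ V.star (δₗ F d m))) ≫ δₗ F c (d ⊙ₗ m) =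
        δₗ F c (d ⊙ₗ m) ≫ c ⊴ₗ δₗ F d m ≫ c ⊴ₗ V.star (δₗ F d m) := by
      rw [δₗ_naturality_right, F.map_preimage, actionHomRight_comp]
    simp only [F.map_comp, F.map_preimage, Category.assoc]
    rw [reassoc_of% h3, h2, h1]
    simp only [Category.assoc, Iso.inv_hom_id_assoc]
    rw [← F.map_comp, Iso.inv_hom_id, F.map_id, Category.comp_id])
  star_app c m := F.map_injective (by
    rw [hF.map_star, F.map_preimage, V.star_comp, V.star_star])
  -- Composing the eigenvector equation with `v*` compares two positive scalars: `r` from `v ≫ v*`,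
  -- and `t` from `F v ≫ δ` and its star. Thus `z = t / r`.
  pos {c a b} hb v hv z hz := by
    have := hF.additive
    have := hF.linear
    obtain ⟨r, hr, er⟩ := hb.comp_star_pos U.isCStar hv
    have hv' : F.map v ≫ δₗ F c a ≠ 0 := fun h0 => hv (F.map_injective (by
      rw [← cancel_mono (δₗ F c a), h0, F.map_zero, zero_comp]))
    obtain ⟨t, ht, et⟩ := (hb.map F).comp_star_pos V.isCStar hv'
    refine ⟨t / r, div_pos ht hr, ?_⟩
    have h1 := congrArg (fun x => F.map (x ≫ U.star v)) hz
    simp only [F.map_comp, F.map_preimage, F.map_smul, Linear.smul_comp] at h1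
    rw [V.star_comp, ← hF.map_star] at et
    simp only [Category.assoc] at et h1
    rw [et, ← F.map_comp v, er, F.map_smul, F.map_id, smul_smul] at h1
    have h2 := (hb.map F).smul_id_injective h1
    have hr' : (r : ℂ) ≠ 0 := Complex.ofReal_ne_zero.2 hr.ne'
    rw [Complex.ofReal_div, eq_div_iff hr', h2]

lemma map_defect_app [F.IsEquivalence] (c : C) (m : M) :
    F.map ((defect V U F hF).app c m) = δₗ F c m ≫ V.star (δₗ F c m) :=
  F.map_preimage _

/-- The structure isomorphisms of a module `*`-functor become unitary after rescaling. -/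
lemma exists_unitary_rescaling [IsBilinearAction C M] [F.IsEquivalence]
    (hC : IsFinitelySemisimple C) (hrigid : ∀ c : C, Nonempty (HasLeftDual c)) :
    ∃ θ : F ≅ F, ∀ (c : C) (m : M), V.IsUnitary
      (θ.inv.app (c ⊙ₗ m) ≫ δₗ F c m ≫ c ⊴ₗ θ.hom.app m) := by
  have hM := U.finitelySemisimple
  obtain ⟨s⟩ := hM.nonempty_simpleFamily
  let g := defect V U F hF
  obtain ⟨κ, hκ, hg⟩ := g.exists_potential U.isCStar hC hrigid hM s
  -- The square root is taken because the rescaling enters `δ ≫ δ*` twice.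
  obtain ⟨Θ, hnat, hΘ, hstar, hstar'⟩ := exists_central_iso hM s U.toStarStructure
    (fun k => Real.sqrt (κ k)) fun k => Real.sqrt_pos.2 (hκ k)
  have hsq (X : M) (k : s.K) (u : s.obj k ⟶ X) :
      u ≫ (Θ X).hom ≫ (Θ X).hom = (κ k : ℂ) • u := by
    rw [← Category.assoc, hΘ, hΘ, smul_smul, ← Complex.ofReal_mul,
      Real.mul_self_sqrt (hκ k).le]
  -- On a simple `b` mapping into `c ⊙ₗ a` with `a` simple, this reads `κ a · (κ b / κ a) = κ b`;
  -- the general case follows by decomposing `m`.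
  have key (c : C) (m : M) : c ⊴ₗ ((Θ m).hom ≫ (Θ m).hom) ≫ g.app c m =
      (Θ (c ⊙ₗ m)).hom ≫ (Θ (c ⊙ₗ m)).hom := by
    refine hM.hom_ext s fun l w => ?_
    rw [hsq]
    obtain ⟨n, t, p, q, hpq⟩ := hM.exists_sum_eq_id s m
    have hsum : c ⊴ₗ (∑ i, p i ≫ q i) = ∑ i, c ⊴ₗ (p i ≫ q i) :=
      map_sum (AddMonoidHom.mk' (fun f : m ⟶ m => c ⊴ₗ f)
        fun f f' => IsBilinearAction.actionHomRight_add c f f') _ _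
    have hw : w = ∑ i, w ≫ c ⊴ₗ p i ≫ c ⊴ₗ q i := by
      conv_lhs => rw [← Category.comp_id w, ← actionHomRight_id, ← hpq, hsum,
        Preadditive.comp_sum]
      simp only [actionHomRight_comp]
    rw [hw, Preadditive.sum_comp, Finset.smul_sum]
    refine Finset.sum_congr rfl fun i _ => ?_
    have h1 : c ⊴ₗ q i ≫ c ⊴ₗ ((Θ m).hom ≫ (Θ m).hom) = (κ (t i) : ℂ) • c ⊴ₗ q i := by
      rw [← actionHomRight_comp, hsq, IsBilinearAction.actionHomRight_smul]
    have h2 := congrArg (· ≫ c ⊴ₗ q i) (hg c (t i) l (w ≫ c ⊴ₗ p i))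
    simp only [Category.assoc, Linear.smul_comp] at h2 ⊢
    rw [reassoc_of% h1, Linear.smul_comp, g.naturality_right, Linear.comp_smul, Linear.comp_smul,
      h2]
  refine ⟨NatIso.ofComponents (fun m => F.mapIso (Θ m)) fun {X Y} f => ?_, fun c m => ?_⟩
  · rw [Functor.mapIso_hom, Functor.mapIso_hom, ← F.map_comp, ← F.map_comp, hnat]
  · simp only [NatIso.ofComponents_hom_app, NatIso.ofComponents_inv_app, Functor.mapIso_hom,
      Functor.mapIso_inv]
    refine StarStructure.IsUnitary.of_isIso ?_
    rw [V.star_comp, V.star_comp, V.star_actionHomRight, ← hF.map_star, ← hF.map_star, hstar,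
      hstar']
    have h1 : δₗ F c m ≫ c ⊴ₗ F.map (Θ m).hom ≫ c ⊴ₗ F.map (Θ m).hom ≫
        V.star (δₗ F c m) = F.map ((Θ (c ⊙ₗ m)).hom ≫ (Θ (c ⊙ₗ m)).hom) := by
      rw [← key, F.map_comp, map_defect_app V U F hF, δₗ_naturality_right_assoc]
      simp
    simp only [Category.assoc]
    rw [reassoc_of% h1, ← F.map_comp, ← F.map_comp]
    simp

end UnitaryModuleStructure

/-- A module equivalence of unitary module categories is isomorphic, as a module functor, to a
unitary module equivalence. -/
theorem exists_unitaryModuleEquivalence {S : StarStructure C} (hC : IsFinitelySemisimple C)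
    (hrigid : ∀ c : C, Nonempty (HasLeftDual c)) [IsBilinearAction C M] [IsBilinearAction C N]
    (U : UnitaryModuleStructure S M) (V : UnitaryModuleStructure S N)
    (E : M ⥤ N) [E.LeftLinear C] [E.IsEquivalence] :
    ∃ (F : M ⥤ N) (_ : F.LeftLinear C),
      IsUnitaryModuleEquivalence U V F ∧ ∃ η : E ≅ F, IsModuleIso C η := by
  have := U.finitelySemisimple.hasFiniteBiproducts
  have : E.Additive := Functor.additive_of_preserves_binary_products E
  have : E.Linear ℂ := ⟨fun f z => map_smul_of_leftLinear C E f z⟩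
  obtain ⟨F, ⟨η⟩, hF⟩ := exists_starFunctor_iso E U.isCStar V.isCStar U.finitelySemisimple
    V.finitelySemisimple
  have hFe : F.IsEquivalence := Functor.isEquivalence_of_iso η
  have hstar := hF.isStarEquivalence U.isCStar V.isCStar U.finitelySemisimple V.finitelySemisimple
  obtain ⟨θ, hθ⟩ : ∃ θ : F ≅ F, letI := leftLinearOfIso (C := C) η
      ∀ (c : C) (m : M), V.IsUnitary (θ.inv.app (c ⊙ₗ m) ≫ δₗ F c m ≫ c ⊴ₗ θ.hom.app m) :=
    letI := leftLinearOfIso (C := C) η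
    UnitaryModuleStructure.exists_unitary_rescaling V U F hF hC hrigid
  -- The functor `F` is kept; only its module structure is changed, by transporting that of `E`
  -- along `η` followed by the rescaling `θ`.
  refine ⟨F, leftLinearOfIso (C := C) (η ≪≫ θ), ?_, η ≪≫ θ, isModuleIso_leftLinearOfIso _⟩
  let _ := leftLinearOfIso (C := C) (η ≪≫ θ)
  refine ⟨hFe, hstar, fun c m => ?_⟩
  have h := hθ c m
  change V.IsUnitary (θ.inv.app _ ≫ (η.inv.app _ ≫ δₗ E c m ≫ c ⊴ₗ η.hom.app m) ≫
    c ⊴ₗ θ.hom.app m) at h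
  change V.IsUnitary ((θ.inv.app _ ≫ η.inv.app _) ≫ δₗ E c m ≫
    c ⊴ₗ (η.hom.app m ≫ θ.hom.app m))
  simpa only [Category.assoc, actionHomRight_comp] using h

end ModuleFunctor

end UnitaryModule

end

theorem mainTheorem8
    {C : Type u₁} [Category.{v₁} C] [Preadditive C] [Linear ℂ C]
    [MonoidalCategory C] [MonoidalPreadditive C] [MonoidalLinear ℂ C]
    (S : UnitaryModule.StarStructure C) (hS : UnitaryModule.IsUnitaryFusion S)
    {M : Type u₂} [Category.{v₂} M] [Preadditive M] [Linear ℂ M]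
    [MonoidalLeftAction C M] [UnitaryModule.IsBilinearAction C M]
    (hM : UnitaryModule.IsUnitarizable S M) :
    -- a unitary structure exists
    Nonempty (UnitaryModule.UnitaryModuleStructure S M) ∧
    -- any two unitary structures on `M` are related by a unitary module equivalence that is
    -- isomorphic, as a module functor, to the identity
    (∀ U U' : UnitaryModule.UnitaryModuleStructure S M,
      ∃ (F : M ⥤ M) (_ : F.LeftLinear C),
        UnitaryModule.IsUnitaryModuleEquivalence U U' F ∧
        ∃ η : 𝟭 M ≅ F, UnitaryModule.IsModuleIso C η) ∧
    -- more generally, a module equivalence from `M` to any unitary module category is isomorphic,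
    -- as a module functor, to a unitary module equivalence
    (∀ (U : UnitaryModule.UnitaryModuleStructure S M)
      (N : Type u₃) [Category.{v₃} N] [Preadditive N] [Linear ℂ N]
      [MonoidalLeftAction C N] [UnitaryModule.IsBilinearAction C N]
      (V : UnitaryModule.UnitaryModuleStructure S N)
      (E : M ⥤ N) [E.LeftLinear C] [E.IsEquivalence],
      ∃ (F : M ⥤ N) (_ : F.LeftLinear C),
        UnitaryModule.IsUnitaryModuleEquivalence U V F ∧
        ∃ η : E ≅ F, UnitaryModule.IsModuleIso C η) := by
  exact ⟨hM.2,
    fun U U' => UnitaryModule.exists_unitaryModuleEquivalence hS.finitelySemisimple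
      (fun c => (hS.rigid c).1) U U' (𝟭 M),
    fun U N _ _ _ _ _ V E _ _ => UnitaryModule.exists_unitaryModuleEquivalence
      hS.finitelySemisimple (fun c => (hS.rigid c).1) U V E⟩
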